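/- Let $d>0$ and let $k\ge 0$ be an integer. There is a constant $D$, depending only on $d$ and $k$, such that the following holds. Let $X_n=\{-1+\frac{2i}{n}: i=0,\dots,n\}$ be the equispaced grid of $n+1$ points in $[-1,1]$, let $X'\subset X_n$ be any subset of $m+1$ nodes (for instance a mock-Chebyshev subset), and let $X''=X_n\setminus X'=\{x''_1,\dots,x''_{n-m}\}$. Put $\omega_m(t)=\prod_{x'\in X'}(t-x')$ and $w_i=\omega_m(x''_i)^2$. Let $p\ge 0$, let $X'''=\{x'''_0,\dots,x'''_p\}\subset X''$ be any set of $p+1$ distinct nodes (for instance a mock-Chebyshev subset), and put $\widetilde w_j=\omega_m(x'''_j)^2$. For $\varphi\in C[-1,1]$ let $\hat Q_{X''}\varphi$ be the polynomial $Q$ of degree at most $p$ that minimizes $\sum_{i=1}^{n-m}w_i\,(\varphi(x''_i)-Q(x''_i))^2$, and let $I_p\varphi$ be the polynomial of degree at most $p$ that interpolates $\varphi$ at $x'''_0,\dots,x'''_p$. Let $\|\cdot\|_\infty$ be the uniform norm on $[-1,1]$, let $\|I_p\|$ be the induced norm of the linear operator $I_p:C[-1,1]\to C[-1,1]$, let $$F_{d,k}=\{\varphi\in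 C^k[-1,1]:\ \|\varphi^{(k)}\|_\infty\le d\},$$ and let $$\|\hat Q_{X''}\|=\sup\{\|\hat Q_{X''}\varphi\|_\infty:\ \varphi\in F_{d,k},\ \|\varphi\|_\infty=1\}$$ be the norm of $\hat Q_{X''}$ with domain $F_{d,k}$ (with the supremum of the empty set read as $0$). Then this supremum is finite and $$\|\hat Q_{X''}\|\le\|I_p\|\left(1+D\,\frac{\left(\sum_{i=1}^{n-m}w_i\right)^{1/2}}{\min_{0\le j\le p}\sqrt{\widetilde w_j}}\,(p+1)^{-k}\right).$$ -/

import Mathlib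

noncomputable section

/-- The interval `Γ = [-1, 1]`; `C(unitSeg, ℝ)` carries the uniform norm. -/
abbrev unitSeg : Set ℝ := Set.Icc (-1 : ℝ) 1

/-- The equispaced node `x_{i,n} = -1 + 2 i / n`, for `i = 0, …, n`. -/
def equiNode (n : ℕ) (i : Fin (n + 1)) : unitSeg :=
  ⟨-1 + 2 / (n : ℝ) * (i : ℝ), by
    have hi : (i : ℝ) ≤ n := by exact_mod_cast Nat.lt_succ_iff.mp i.2
    have hn : (0 : ℝ) ≤ n := Nat.cast_nonneg n
    have h0 : (0 : ℝ) ≤ 2 / (n : ℝ) * (i : ℝ) := by positivity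
    have h1 : 2 / (n : ℝ) * (i : ℝ) ≤ 2 := by
      rw [div_mul_eq_mul_div]
      exact div_le_of_le_mul₀ hn (by norm_num) (by linarith)
    constructor <;> linarith⟩

/-- The equispaced grid `X_n`, a set of `n + 1` points when `n ≥ 1`. -/
def equiGrid (n : ℕ) : Finset unitSeg := Finset.univ.image (equiNode n)

/-- The nodal polynomial `ω(t) = ∏ (t - x')` of a node set `X'`. -/
def nodalPoly (X' : Finset unitSeg) (t : ℝ) : ℝ := ∏ x ∈ X', (t - (x : ℝ))

/-- The weight `ω²` at a node. -/
def nodalWeight (X' : Finset unitSeg) (x : unitSeg) : ℝ := nodalPoly X' x ^ 2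

/-- The square of the discrete weighted `2`-norm of `φ - P`, with weights `w` on the node set `Y`. -/
def lsqError (Y : Finset unitSeg) (w : unitSeg → ℝ) (φ : C(unitSeg, ℝ)) (P : Polynomial ℝ) : ℝ :=
  ∑ x ∈ Y, w x * (φ x - P.eval (x : ℝ)) ^ 2

/-- `Q` solves the weighted least-squares problem for `φ` among the polynomials of degree `≤ p`. -/
def IsLeastSquaresPoly (Y : Finset unitSeg) (w : unitSeg → ℝ) (p : ℕ) (φ : C(unitSeg, ℝ))
    (Q : Polynomial ℝ) : Prop :=
  Q ∈ Polynomial.degreeLE ℝ p ∧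
    ∀ R ∈ Polynomial.degreeLE ℝ p, lsqError Y w φ Q ≤ lsqError Y w φ R

theorem exists_isLeastSquaresPoly (Y : Finset unitSeg) (w : unitSeg → ℝ) (hw : ∀ x, 0 ≤ w x)
    (p : ℕ) (φ : C(unitSeg, ℝ)) : ∃ Q, IsLeastSquaresPoly Y w p φ Q := by
  classical
  let L : Polynomial ℝ →ₗ[ℝ] EuclideanSpace ℝ Y :=
    { toFun := fun P => WithLp.toLp 2 (fun x => √(w x) * P.eval ((x : unitSeg) : ℝ))
      map_add' := by
        intro P Q; ext x; simp [mul_add]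
      map_smul' := by
        intro c P; ext x; simp; ring }
  let v : EuclideanSpace ℝ Y := WithLp.toLp 2 (fun x => √(w x) * φ x)
  have key : ∀ P, lsqError Y w φ P = ‖v - L P‖ ^ 2 := by
    intro P
    rw [EuclideanSpace.real_norm_sq_eq, lsqError, ← Finset.sum_coe_sort]
    refine Finset.sum_congr rfl fun x _ => ?_
    simp only [v, L, LinearMap.coe_mk, AddHom.coe_mk, PiLp.sub_apply]
    rw [← mul_sub, mul_pow, Real.sq_sqrt (hw _)]
  let K := (Polynomial.degreeLE ℝ p).map L
  obtain ⟨u, hu, hmin⟩ := K.exists_norm_eq_iInf_of_complete_subspace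
    (Submodule.complete_of_finiteDimensional K) v
  obtain ⟨Q, hQ, rfl⟩ := Submodule.mem_map.mp hu
  refine ⟨Q, hQ, fun R hR => ?_⟩
  rw [key, key]
  refine pow_le_pow_left₀ (norm_nonneg _) ?_ 2
  rw [hmin]
  exact ciInf_le ⟨0, by rintro _ ⟨y, rfl⟩; exact norm_nonneg _⟩
    (⟨L R, Submodule.mem_map_of_mem hR⟩ : K)

/-- The least-squares solution is unique for positive weights on more than `p` nodes. -/
theorem IsLeastSquaresPoly.unique {Y : Finset unitSeg} {w : unitSeg → ℝ} {p : ℕ}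
    {φ : C(unitSeg, ℝ)} {Q R : Polynomial ℝ} (hw : ∀ x ∈ Y, 0 < w x) (hp : p < Y.card)
    (hQ : IsLeastSquaresPoly Y w p φ Q) (hR : IsLeastSquaresPoly Y w p φ R) : Q = R := by
  have hM : (1 / 2 : ℝ) • (Q + R) ∈ Polynomial.degreeLE ℝ p :=
    Submodule.smul_mem _ _ (Submodule.add_mem _ hQ.1 hR.1)
  have h1 := hQ.2 _ hM
  have h2 := hR.2 _ hM
  have hid : lsqError Y w φ ((1 / 2 : ℝ) • (Q + R)) =
      (lsqError Y w φ Q + lsqError Y w φ R) / 2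
        - ∑ x ∈ Y, w x * ((Q.eval (x : ℝ) - R.eval (x : ℝ)) ^ 2 / 4) := by
    simp only [lsqError, ← Finset.sum_add_distrib, Finset.sum_div, ← Finset.sum_sub_distrib]
    refine Finset.sum_congr rfl fun x _ => ?_
    simp only [Polynomial.eval_smul, Polynomial.eval_add, smul_eq_mul]
    ring
  have hnn : ∀ x ∈ Y, 0 ≤ w x * ((Q.eval (x : ℝ) - R.eval (x : ℝ)) ^ 2 / 4) := fun x hx =>
    mul_nonneg (hw x hx).le (by positivity)
  have h0 : ∑ x ∈ Y, w x * ((Q.eval (x : ℝ) - R.eval (x : ℝ)) ^ 2 / 4) = 0 :=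
    le_antisymm (by linarith) (Finset.sum_nonneg hnn)
  have hz := (Finset.sum_eq_zero_iff_of_nonneg hnn).mp h0
  refine Polynomial.eq_of_degree_sub_lt_of_eval_finset_eq
    (Y.map (Function.Embedding.subtype _)) ?_ ?_
  · have : Q - R ∈ Polynomial.degreeLE ℝ p := Submodule.sub_mem _ hQ.1 hR.1
    rw [Finset.card_map]
    exact lt_of_le_of_lt (Polynomial.mem_degreeLE.mp this) (by exact_mod_cast hp)
  · intro t ht
    obtain ⟨x, hx, rfl⟩ := Finset.mem_map.mp ht
    have := hz x hx
    rcases mul_eq_zero.mp this with h | h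
    · exact absurd h (hw x hx).ne'
    · have h4 : (Q.eval (x : ℝ) - R.eval (x : ℝ)) ^ 2 = 0 := by linarith
      exact sub_eq_zero.mp (pow_eq_zero_iff (two_ne_zero)|>.mp h4)

/-- The least-squares operator `Q̂_{X''}` of degree `p` on the node set `X''`, with weights
`w = ω²`, where `ω` is the nodal polynomial of `X'`. -/
def lsqPoly (X' X'' : Finset unitSeg) (p : ℕ) (φ : C(unitSeg, ℝ)) : Polynomial ℝ :=
  (exists_isLeastSquaresPoly X'' (nodalWeight X') (fun _ => sq_nonneg _) p φ).choose

theorem lsqPoly_spec (X' X'' : Finset unitSeg) (p : ℕ) (φ : C(unitSeg, ℝ)) :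
    IsLeastSquaresPoly X'' (nodalWeight X') p φ (lsqPoly X' X'' p φ) :=
  (exists_isLeastSquaresPoly X'' (nodalWeight X') (fun _ => sq_nonneg _) p φ).choose_spec

/-- `Q̂_{X''}` as a map into `C[-1, 1]`. -/
def lsqOp (X' X'' : Finset unitSeg) (p : ℕ) (φ : C(unitSeg, ℝ)) : C(unitSeg, ℝ) :=
  (lsqPoly X' X'' p φ).toContinuousMapOn unitSeg

/-- The interpolation operator `I_p` on `C[-1, 1]` at the nodes `z 0, …, z p`, written in the
Lagrange basis. Its norm is the operator norm induced by the uniform norm. -/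
def interpOp {p : ℕ} (z : Fin (p + 1) → unitSeg) : C(unitSeg, ℝ) →L[ℝ] C(unitSeg, ℝ) :=
  ∑ j, (ContinuousMap.evalCLM ℝ (z j)).smulRight
    ((Lagrange.basis Finset.univ (fun i => (z i : ℝ)) j).toContinuousMapOn unitSeg)

/-- `I_p φ` is the Lagrange interpolation polynomial of `φ`. -/
theorem interpOp_apply {p : ℕ} (z : Fin (p + 1) → unitSeg) (φ : C(unitSeg, ℝ)) :
    interpOp z φ = (Lagrange.interpolate Finset.univ (fun i => (z i : ℝ))
      (fun j => φ (z j))).toContinuousMapOn unitSeg := by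
  ext t
  simp [interpOp, Lagrange.interpolate_apply, Polynomial.eval_finsetSum]

/-- The class `F_{d,k,Γ}` of the functions of class `C^k` on `[-1, 1]` (one-sided derivatives at the
end points) whose `k`-th derivative is bounded by `d` in the uniform norm. -/
def smoothClass (d : ℝ) (k : ℕ) : Set C(unitSeg, ℝ) :=
  {φ | ContDiffOn ℝ k (Set.IccExtend (by norm_num : (-1 : ℝ) ≤ 1) φ) unitSeg ∧
    ∀ t ∈ unitSeg,
      |iteratedDerivWithin k (Set.IccExtend (by norm_num : (-1 : ℝ) ≤ 1) φ) unitSeg t| ≤ d}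

/-- The values `‖T φ‖` for `φ` in the domain `F` with `‖φ‖ = 1`. -/
def unitValues (F : Set C(unitSeg, ℝ)) (T : C(unitSeg, ℝ) → C(unitSeg, ℝ)) : Set ℝ :=
  {y | ∃ φ ∈ F, ‖φ‖ = 1 ∧ y = ‖T φ‖}

/-- The norm `sup {‖T φ‖ : φ ∈ F, ‖φ‖ = 1}` of the operator `T` with domain `F`. -/
def normOn (F : Set C(unitSeg, ℝ)) (T : C(unitSeg, ℝ) → C(unitSeg, ℝ)) : ℝ :=
  sSup (unitValues F T)

end

/-! Interpolation reproduces polynomials of degree at most `p`, so `Q̂φ = I_p φ + I_p (Q̂φ - φ)`.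
The second term sees only the residual at the nodes `z j`. There one weighted squared residual is at
most the whole least-squares error, which by minimality is at most `ε² ∑ w` for any competitor of
degree at most `p` with uniform error `ε` (`abs_sub_lsqPoly_le`). Dividing by the smallest `√w` at
the nodes gives the bound (`norm_lsqOp_le`).

It remains to take `ε = D (p + 1)^{-k}`, which is Jackson's theorem. The Lipschitz case averages `f
∘ cos` over an equispaced grid of angles with the kernel `|A|²`, where `A = (1 + X + ⋯ + X^{r-1})²`;
discrete Parseval turns its mass and first moment into sums of squared coefficients. The `C^k` case
follows by induction, integrating an approximant of the derivative. -/

/-! ### Discrete trigonometric kernels and Jackson's estimate for Lipschitz functions. -/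

section TrigonometricKernel

open Polynomial Finset

/-- The squared modulus of a real polynomial on the unit circle, as a function of the angle. -/
noncomputable def circleNormSq (A : ℝ[X]) (s : ℝ) : ℝ := ‖aeval (Complex.exp (s * Complex.I)) A‖ ^ 2

theorem circleNormSq_nonneg (A : ℝ[X]) (s : ℝ) : 0 ≤ circleNormSq A s := sq_nonneg _

theorem circleNormSq_eq_sum {A : ℝ[X]} {N : ℕ} (hN : A.natDegree < N) (s : ℝ) :
    circleNormSq A s = ∑ j ∈ range N, ∑ k ∈ range N,
      A.coeff j * A.coeff k * Real.cos (((j : ℤ) - (k : ℤ) : ℤ) * s) := by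
  have hA : aeval (Complex.exp (s * Complex.I)) A =
      ∑ j ∈ range N, (A.coeff j : ℂ) * Complex.exp ((j * s : ℝ) * Complex.I) := by
    rw [aeval_eq_sum_range' hN]
    refine sum_congr rfl fun j _ => ?_
    rw [← Complex.exp_nat_mul, Complex.real_smul]
    push_cast
    ring_nf
  have hre : (aeval (Complex.exp (s * Complex.I)) A).re =
      ∑ j ∈ range N, A.coeff j * Real.cos (j * s) := by
    rw [hA, Complex.re_sum]
    exact sum_congr rfl fun j _ => by
      rw [Complex.re_ofReal_mul, Complex.exp_ofReal_mul_I_re]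
  have him : (aeval (Complex.exp (s * Complex.I)) A).im =
      ∑ j ∈ range N, A.coeff j * Real.sin (j * s) := by
    rw [hA, Complex.im_sum]
    exact sum_congr rfl fun j _ => by
      rw [Complex.im_ofReal_mul, Complex.exp_ofReal_mul_I_im]
  rw [circleNormSq, ← Complex.normSq_eq_norm_sq, Complex.normSq_apply, hre, him, sum_mul_sum,
    sum_mul_sum, ← sum_add_distrib]
  refine sum_congr rfl fun j _ => ?_
  rw [← sum_add_distrib]
  refine sum_congr rfl fun k _ => ?_
  have : (((j : ℤ) - (k : ℤ) : ℤ) : ℝ) * s = j * s - k * s := by push_cast; ring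
  rw [this, Real.cos_sub]
  ring

/-- Real part of a geometric sum whose ratio is an `N`-th root of unity other than `1`. -/
theorem sum_cos_equispaced {N : ℕ} {m : ℤ} (hm : ¬ (N : ℤ) ∣ m) (θ : ℝ) :
    ∑ l ∈ range N, Real.cos (m * (2 * Real.pi * l / N + θ)) = 0 := by
  rcases Nat.eq_zero_or_pos N with rfl | hN
  · simp
  have hN' : (N : ℂ) ≠ 0 := by exact_mod_cast hN.ne'
  set ζ : ℂ := Complex.exp (2 * Real.pi * Complex.I / N) with hζ
  have hprim : IsPrimitiveRoot ζ N := Complex.isPrimitiveRoot_exp N hN.ne'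
  have hne : ζ ^ m ≠ 1 := fun h => hm (hprim.zpow_eq_one_iff_dvd m |>.mp h)
  have hpow : (ζ ^ m) ^ N = 1 := by
    rw [← zpow_natCast, ← zpow_mul, mul_comm, zpow_mul, zpow_natCast, hprim.pow_eq_one, one_zpow]
  have hgeom : ∑ l ∈ range N, (ζ ^ m) ^ l = 0 := by
    rw [geom_sum_eq hne, hpow]; simp
  have hterm : ∀ l ∈ range N, Real.cos (m * (2 * Real.pi * l / N + θ)) =
      (Complex.exp ((m * θ : ℝ) * Complex.I) * (ζ ^ m) ^ l).re := by
    intro l _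
    rw [← Complex.exp_ofReal_mul_I_re, hζ, ← Complex.exp_int_mul, ← Complex.exp_nat_mul,
      ← Complex.exp_add]
    congr 2
    push_cast
    field_simp
    ring
  rw [sum_congr rfl hterm, ← Complex.re_sum, ← mul_sum, hgeom]
  simp

/-- Parseval's identity on an equispaced grid of the circle. -/
theorem sum_circleNormSq_equispaced {A : ℝ[X]} {N : ℕ} (hN : A.natDegree < N) (θ : ℝ) :
    ∑ l ∈ range N, circleNormSq A (2 * Real.pi * l / N + θ) =
      N * ∑ j ∈ range N, A.coeff j ^ 2 := by
  simp_rw [circleNormSq_eq_sum hN]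
  rw [sum_comm, mul_sum]
  refine sum_congr rfl fun j hj => ?_
  rw [sum_comm, sum_eq_single_of_mem j hj]
  · simp only [sub_self, Int.cast_zero, zero_mul, Real.cos_zero, mul_one, sum_const, card_range,
      nsmul_eq_mul]
    ring
  · intro k hk hkj
    rw [← mul_sum, sum_cos_equispaced, mul_zero]
    intro hdvd
    have h1 := mem_range.mp hj
    have h2 := mem_range.mp hk
    have := Int.eq_zero_of_abs_lt_dvd hdvd (by rw [abs_lt]; constructor <;> omega)
    omega

/-- Adding the values at `t - θ` and `t + θ` cancels the sines in `θ`; the remaining cosines are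
Chebyshev polynomials in `cos θ`. -/
theorem exists_polynomial_circleNormSq {A : ℝ[X]} {N : ℕ} (hN : A.natDegree < N) (t : ℝ) :
    ∃ q ∈ degreeLT ℝ N, ∀ θ, q.eval (Real.cos θ) =
      circleNormSq A (t - θ) + circleNormSq A (t + θ) := by
  refine ⟨∑ j ∈ range N, ∑ k ∈ range N, (A.coeff j * A.coeff k *
    (2 * Real.cos (((j : ℤ) - (k : ℤ) : ℤ) * t))) • Chebyshev.T ℝ ((j : ℤ) - (k : ℤ)), ?_, ?_⟩
  · refine sum_mem fun j hj => sum_mem fun k hk => Submodule.smul_mem _ _ ?_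
    rw [mem_degreeLT, Chebyshev.degree_T]
    have h1 := mem_range.mp hj
    have h2 := mem_range.mp hk
    exact_mod_cast (by omega : ((j : ℤ) - (k : ℤ)).natAbs < N)
  · intro θ
    rw [circleNormSq_eq_sum hN, circleNormSq_eq_sum hN, eval_finsetSum, ← sum_add_distrib]
    refine sum_congr rfl fun j _ => ?_
    rw [eval_finsetSum, ← sum_add_distrib]
    refine sum_congr rfl fun k _ => ?_
    rw [eval_smul, Chebyshev.T_real_cos, mul_sub, mul_add, Real.cos_sub, Real.cos_add, smul_eq_mul]
    ring

theorem abs_cos_sub_cos_le_norm (θ t : ℝ) :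
    |Real.cos θ - Real.cos t| ≤ ‖1 - Complex.exp ((t - θ : ℝ) * Complex.I)‖ := by
  have h : ‖Complex.exp (θ * Complex.I) - Complex.exp (t * Complex.I)‖ =
      ‖1 - Complex.exp ((t - θ : ℝ) * Complex.I)‖ := by
    have : Complex.exp (θ * Complex.I) - Complex.exp (t * Complex.I) =
        Complex.exp (θ * Complex.I) * (1 - Complex.exp ((t - θ : ℝ) * Complex.I)) := by
      rw [mul_sub, mul_one, ← Complex.exp_add]
      congr 2
      push_cast
      ring
    rw [this, norm_mul, Complex.norm_exp_ofReal_mul_I, one_mul]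
  rw [← h]
  refine le_trans (le_of_eq ?_) (Complex.abs_re_le_norm _)
  rw [Complex.sub_re, Complex.exp_ofReal_mul_I_re, Complex.exp_ofReal_mul_I_re]

/-- The mean distance to the point of angle `0`, for the density `|A|²` on an equispaced grid. -/
theorem sum_norm_mul_circleNormSq_le {A : ℝ[X]} {N : ℕ} (hN : A.natDegree + 1 < N) {c a : ℝ}
    (hc : 0 ≤ c) (ha : ∑ j ∈ range N, A.coeff j ^ 2 = a)
    (h : ∑ j ∈ range N, ((1 - X) * A).coeff j ^ 2 ≤ c ^ 2 * a) (θ : ℝ) :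
    ∑ l ∈ range N, ‖1 - Complex.exp ((2 * Real.pi * l / N + θ : ℝ) * Complex.I)‖ *
      circleNormSq A (2 * Real.pi * l / N + θ) ≤ c * (N * a) := by
  have ha0 : 0 ≤ a := ha ▸ sum_nonneg fun _ _ => sq_nonneg _
  have hdeg : ((1 - X : ℝ[X]) * A).natDegree < N := by
    refine lt_of_le_of_lt natDegree_mul_le ?_
    have : (1 - X : ℝ[X]).natDegree ≤ 1 := by
      refine (natDegree_sub_le _ _).trans ?_
      simp
    omega
  -- Cauchy–Schwarz puts the distance with one factor `|A|`, producing `|(1 - X) A|²`, to which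
  -- Parseval applies.
  have hcs := sum_mul_sq_le_sq_mul_sq (range N)
    (fun l : ℕ => ‖1 - Complex.exp ((2 * Real.pi * l / N + θ : ℝ) * Complex.I)‖ *
      ‖aeval (Complex.exp ((2 * Real.pi * l / N + θ : ℝ) * Complex.I)) A‖)
    (fun l : ℕ => ‖aeval (Complex.exp ((2 * Real.pi * l / N + θ : ℝ) * Complex.I)) A‖)
  have h1 : ∀ l ∈ range N, (‖1 - Complex.exp ((2 * Real.pi * l / N + θ : ℝ) * Complex.I)‖ *
      ‖aeval (Complex.exp ((2 * Real.pi * l / N + θ : ℝ) * Complex.I)) A‖) ^ 2 =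
      circleNormSq ((1 - X) * A) (2 * Real.pi * l / N + θ) := by
    intro l _
    rw [circleNormSq, map_mul, norm_mul, map_sub, map_one, aeval_X]
  have h2 := sum_circleNormSq_equispaced (A := A) (N := N) (by omega) θ
  rw [sum_congr rfl h1, sum_circleNormSq_equispaced hdeg] at hcs
  simp only [circleNormSq] at h2 ⊢
  rw [h2, ha] at hcs
  refine abs_le_of_sq_le_sq' ?_ (by positivity) |>.2
  calc _ = _ := by
        congr 1
        exact sum_congr rfl fun l _ => by rw [sq, ← mul_assoc]
    _ ≤ _ := hcs
    _ ≤ N * (c ^ 2 * a) * (N * a) := by gcongr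
    _ = _ := by ring

/-- A trigonometric convolution on a grid approximates Lipschitz functions by polynomials. -/
theorem exists_polynomial_approx_of_kernel {A : ℝ[X]} {N : ℕ} (hN : A.natDegree + 1 < N) {c a : ℝ}
    (hc : 0 ≤ c) (ha : ∑ j ∈ range N, A.coeff j ^ 2 = a) (ha0 : 0 < a)
    (h : ∑ j ∈ range N, ((1 - X) * A).coeff j ^ 2 ≤ c ^ 2 * a)
    {f : ℝ → ℝ} {L : ℝ} (hL : 0 ≤ L)
    (hf : ∀ x ∈ unitSeg, ∀ y ∈ unitSeg, |f x - f y| ≤ L * |x - y|) :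
    ∃ P ∈ degreeLT ℝ (A.natDegree + 1), ∀ x ∈ unitSeg, |f x - P.eval x| ≤ L * c := by
  choose q hq hqe using fun t : ℝ =>
    exists_polynomial_circleNormSq (Nat.lt_succ_self A.natDegree) t
  have hN0 : (0 : ℝ) < N := by exact_mod_cast (by omega : 0 < N)
  set τ : ℕ → ℝ := fun l => 2 * Real.pi * l / N with hτ
  -- Each of the two kernel copies in `q` has total mass `N * a`, so the weights on the values of
  -- `f` sum to `1`.
  refine ⟨∑ l ∈ range N, (f (Real.cos (τ l)) / (2 * (N * a))) • q (τ l),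
    sum_mem fun l _ => Submodule.smul_mem _ _ (hq _), fun x hx => ?_⟩
  obtain ⟨θ, rfl⟩ : ∃ θ, Real.cos θ = x := ⟨Real.arccos x, Real.cos_arccos hx.1 hx.2⟩
  have hmass : ∀ s : ℝ, ∑ l ∈ range N, circleNormSq A (τ l + s) = N * a := fun s => by
    rw [← ha]; exact sum_circleNormSq_equispaced (by omega) s
  have hdist : ∀ s : ℝ, Real.cos s = Real.cos θ →
      |∑ l ∈ range N, (f (Real.cos θ) - f (Real.cos (τ l))) * circleNormSq A (τ l + -s)| ≤
        L * (c * (N * a)) := by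
    intro s hs
    refine le_trans (abs_sum_le_sum_abs _ _) ?_
    refine le_trans (sum_le_sum fun l _ => ?_)
      (le_trans (mul_sum (range N) _ L).symm.le (mul_le_mul_of_nonneg_left
        (sum_norm_mul_circleNormSq_le hN hc ha h (-s)) hL))
    rw [abs_mul, abs_of_nonneg (circleNormSq_nonneg _ _), ← mul_assoc]
    refine mul_le_mul_of_nonneg_right ?_ (circleNormSq_nonneg _ _)
    refine (hf _ hx _ ⟨Real.neg_one_le_cos _, Real.cos_le_one _⟩).trans ?_
    refine mul_le_mul_of_nonneg_left ?_ hL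
    rw [← hs]
    exact abs_cos_sub_cos_le_norm s (τ l)
  have h1 := hdist θ rfl
  have h2 := hdist (-θ) (Real.cos_neg θ)
  have key : f (Real.cos θ) -
      (∑ l ∈ range N, (f (Real.cos (τ l)) / (2 * (N * a))) • q (τ l)).eval (Real.cos θ) =
      (∑ l ∈ range N, (f (Real.cos θ) - f (Real.cos (τ l))) * circleNormSq A (τ l + -θ) +
      ∑ l ∈ range N, (f (Real.cos θ) - f (Real.cos (τ l))) * circleNormSq A (τ l + - -θ)) /
        (2 * (N * a)) := by
    simp_rw [sub_mul, sum_sub_distrib, ← mul_sum, hmass, eval_finsetSum, eval_smul, hqe,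
      smul_eq_mul, neg_neg, ← sub_eq_add_neg, mul_add, sum_add_distrib, div_mul_eq_mul_div,
      ← sum_div]
    field_simp
    ring
  rw [key, abs_div, abs_of_pos (by positivity : 0 < 2 * (N * a)), div_le_iff₀ (by positivity)]
  refine (abs_add_le _ _).trans ?_
  linarith

/-- With `A = G²`, multiplying by `1 - X` telescopes one factor `G`: the squared coefficient norm
drops from at least `r³ / 2` to at most `2 r`, whence `c = 2 / r`. -/
theorem exists_polynomial_approx_of_lipschitz {f : ℝ → ℝ} {L : ℝ} (hL : 0 ≤ L)
    (hf : ∀ x ∈ unitSeg, ∀ y ∈ unitSeg, |f x - f y| ≤ L * |x - y|) {n : ℕ} (hn : 0 < n) :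
    ∃ P ∈ degreeLT ℝ n, ∀ x ∈ unitSeg, |f x - P.eval x| ≤ 4 * L / n := by
  -- The bound `2 r ≤ n + 1` keeps the degree `2 r - 2` of `G²` below `n`; `n ≤ 2 r` turns `2 / r`
  -- into at most `4 / n`.
  obtain ⟨r, hr, hrn, hnr⟩ : ∃ r : ℕ, 0 < r ∧ 2 * r ≤ n + 1 ∧ n ≤ 2 * r :=
    ⟨(n + 1) / 2, by omega, by omega, by omega⟩
  set G : ℝ[X] := ∑ i ∈ range r, X ^ i with hG
  have hr0 : (0 : ℝ) < r := by exact_mod_cast hr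
  have hGdeg : G.natDegree ≤ r - 1 := natDegree_sum_le_of_forall_le _ _ fun i hi => by
    rw [natDegree_X_pow]; have := mem_range.mp hi; omega
  have hGcoeff : ∀ j, G.coeff j = if j < r then 1 else 0 := by
    intro j
    simp [hG, coeff_X_pow]
  have hdeg : (G ^ 2).natDegree + 1 ≤ 2 * r - 1 := by
    have : (G ^ 2).natDegree ≤ 2 * (r - 1) := natDegree_pow_le_of_le 2 hGdeg
    omega
  have hsum : ∑ j ∈ range (2 * r), (G ^ 2).coeff j = (r : ℝ) ^ 2 := by
    have := eval_eq_sum_range' (p := G ^ 2) (n := 2 * r) (by omega) 1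
    simp only [one_pow, mul_one] at this
    rw [← this]
    simp [hG, eval_finsetSum]
  -- Cauchy–Schwarz: the coefficient sum `G(1)² = r²` is spread over `2 r` places.
  have ha : (r : ℝ) ^ 3 / 2 ≤ ∑ j ∈ range (2 * r), (G ^ 2).coeff j ^ 2 := by
    have := sq_sum_le_card_mul_sum_sq (s := range (2 * r)) (f := fun j => (G ^ 2).coeff j)
    rw [hsum, card_range] at this
    push_cast at this
    refine le_of_mul_le_mul_left (a := 2 * (r : ℝ)) (le_trans (le_of_eq ?_) this) (by positivity)
    ring
  have hb : ∑ j ∈ range (2 * r), ((1 - X) * G ^ 2).coeff j ^ 2 ≤ 2 * (r : ℝ) := by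
    have hid : (1 - X) * G ^ 2 = G - X ^ r * G := by
      have := mul_neg_geom_sum (X : ℝ[X]) r
      rw [sq, ← mul_assoc, hG, this]
      ring
    refine (sum_le_sum (g := fun _ => (1 : ℝ)) fun j _ => ?_).trans (by simp)
    rw [hid, coeff_sub, coeff_X_pow_mul', hGcoeff, hGcoeff]
    split_ifs <;> norm_num
  have hpos : (0 : ℝ) < ∑ j ∈ range (2 * r), (G ^ 2).coeff j ^ 2 := lt_of_lt_of_le (by positivity) ha
  obtain ⟨P, hP, hPf⟩ := exists_polynomial_approx_of_kernel (A := G ^ 2) (N := 2 * r) (c := 2 / r)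
    (by omega) (by positivity) rfl hpos (hb.trans (le_trans (le_of_eq (by field_simp))
      (mul_le_mul_of_nonneg_left ha (by positivity)))) hL hf
  refine ⟨P, degreeLT_mono (by omega) hP, fun x hx => (hPf x hx).trans ?_⟩
  have hn0 : (0 : ℝ) < n := by exact_mod_cast hn
  have : (n : ℝ) ≤ 2 * r := by exact_mod_cast hnr
  rw [mul_div_assoc', div_le_div_iff₀ hr0 hn0]
  nlinarith

end TrigonometricKernel

/-! ### Jackson's theorem for higher smoothness. -/

section JacksonTheorem

open Polynomial

theorem exists_derivative_eq_of_mem_degreeLT {q : ℝ[X]} {n : ℕ} (hq : q ∈ degreeLT ℝ n) :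
    ∃ Q ∈ degreeLT ℝ (n + 1), derivative Q = q := by
  rcases eq_or_ne q 0 with rfl | h0
  · exact ⟨0, Submodule.zero_mem _, derivative_zero⟩
  rw [mem_degreeLT] at hq
  refine ⟨∑ i ∈ Finset.range n, monomial (i + 1) (q.coeff i / (i + 1)), ?_, ?_⟩
  · refine sum_mem fun i hi => ?_
    rw [mem_degreeLT]
    refine (degree_monomial_le _ _).trans_lt ?_
    have := Finset.mem_range.mp hi
    exact_mod_cast (by omega : i + 1 < n + 1)
  · rw [derivative_sum]
    conv_rhs => rw [as_sum_range' q n ((natDegree_lt_iff_degree_lt h0).mpr hq)]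
    refine Finset.sum_congr rfl fun i _ => ?_
    rw [derivative_monomial]
    have : (i : ℝ) + 1 ≠ 0 := by positivity
    simp [this]

/-- Jackson's theorem for `C^k` functions on `[-1, 1]`. -/
theorem exists_polynomial_approx_of_contDiffOn (k : ℕ) :
    ∃ C : ℝ, 0 ≤ C ∧ ∀ (f : ℝ → ℝ) (M : ℝ), 0 ≤ M → ContDiffOn ℝ k f unitSeg →
      (∀ t ∈ unitSeg, |iteratedDerivWithin k f unitSeg t| ≤ M) → ∀ n : ℕ, k ≤ n →
      ∃ P ∈ degreeLT ℝ n, ∀ x ∈ unitSeg, |f x - P.eval x| ≤ C * M / (n : ℝ) ^ k := by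
  have hud : UniqueDiffOn ℝ unitSeg := uniqueDiffOn_Icc (by norm_num)
  induction k with
  | zero =>
    refine ⟨1, zero_le_one, fun f M _ _ hM n _ => ⟨0, Submodule.zero_mem _, fun x hx => ?_⟩⟩
    simpa using hM x hx
  | succ k ih =>
    obtain ⟨C, hC, ih⟩ := ih
    -- The `4` is the Lipschitz constant factor; `2 ^ k` pays for replacing `n ^ k` by `(n + 1) ^
    -- k`.
    refine ⟨4 * (C * 2 ^ k), by positivity, fun f M hM0 hf hM n hn => ?_⟩
    obtain ⟨n, rfl⟩ : ∃ l, n = l + 1 := ⟨n - 1, by omega⟩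
    have hkn : k ≤ n := by omega
    obtain ⟨q, hq, hqf⟩ := ih (derivWithin f unitSeg) M hM0
      (hf.derivWithin hud (by push_cast; exact le_rfl))
      (fun t ht => by rw [← iteratedDerivWithin_succ']; exact hM t ht) n hkn
    obtain ⟨Q, hQ, rfl⟩ := exists_derivative_eq_of_mem_degreeLT hq
    set ε := C * M / (n : ℝ) ^ k with hε
    have hε0 : 0 ≤ ε := by positivity
    have hd : ∀ x ∈ unitSeg, HasDerivWithinAt (fun y => f y - Q.eval y)
        (derivWithin f unitSeg x - (derivative Q).eval x) unitSeg x := fun x hx =>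
      (((hf.differentiableOn (by simp)) x hx).hasDerivWithinAt).sub (Q.hasDerivWithinAt x _)
    have hlip : ∀ x ∈ unitSeg, ∀ y ∈ unitSeg,
        |(f x - Q.eval x) - (f y - Q.eval y)| ≤ ε * |x - y| := fun x hx y hy =>
      (convex_Icc (-1 : ℝ) 1).norm_image_sub_le_of_norm_hasDerivWithin_le hd
        (fun t ht => hqf t ht) hy hx
    -- `f - Q` is `ε`-Lipschitz, so approximating it gains one more factor `1 / (n + 1)`.
    obtain ⟨P, hP, hPf⟩ := exists_polynomial_approx_of_lipschitz hε0 hlip (Nat.succ_pos n)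
    refine ⟨Q + P, Submodule.add_mem _ hQ hP, fun x hx => ?_⟩
    rw [eval_add, ← sub_sub]
    refine (hPf x hx).trans ?_
    have hn1 : (0 : ℝ) < (n + 1 : ℕ) := by positivity
    have hpow : ((n + 1 : ℕ) : ℝ) ^ k ≤ 2 ^ k * (n : ℝ) ^ k := by
      -- For `k = 0` the value `n = 0` is allowed, where `n + 1 ≤ 2 * n` fails but both powers are
      -- `1`.
      rcases Nat.eq_zero_or_pos k with rfl | hk
      · simp
      · rw [← mul_pow]
        gcongr
        exact_mod_cast (by omega : n + 1 ≤ 2 * n)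
    have hnk : 0 < (n : ℝ) ^ k := by
      rcases Nat.eq_zero_or_pos k with rfl | hk
      · simp
      · have : (0 : ℝ) < n := by exact_mod_cast (by omega : 0 < n)
        positivity
    have : ε ≤ C * 2 ^ k * M / ((n + 1 : ℕ) : ℝ) ^ k := by
      rw [hε, div_le_div_iff₀ hnk (by positivity)]
      have := mul_le_mul_of_nonneg_left hpow (mul_nonneg hC hM0)
      linarith
    rw [pow_succ, ← div_div]
    gcongr
    calc 4 * ε ≤ 4 * (C * 2 ^ k * M / ((n + 1 : ℕ) : ℝ) ^ k) := by gcongr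
      _ = _ := by ring

end JacksonTheorem

/-! ### Stability of least squares through interpolation. -/

section LeastSquares

open Polynomial

/-- The smooth class is approximated at the rate `(p + 1)^{-k}`, uniformly in `p`. -/
theorem exists_jackson_constant_smoothClass {d : ℝ} (hd : 0 ≤ d) (k : ℕ) :
    ∃ D : ℝ, 0 ≤ D ∧ ∀ φ ∈ smoothClass d k, ‖φ‖ = 1 → ∀ p : ℕ,
      ∃ P ∈ degreeLE ℝ p, ∀ x : unitSeg, |φ x - P.eval (x : ℝ)| ≤ D * ((p : ℝ) + 1) ^ (-(k : ℤ)) := by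
  obtain ⟨C, hC, hJ⟩ := exists_polynomial_approx_of_contDiffOn k
  -- The term `k ^ k` covers `p + 1 < k`, outside Jackson's range: the zero polynomial has error at
  -- most `1 ≤ k ^ k / (p + 1) ^ k`.
  refine ⟨C * d + (k : ℝ) ^ k, by positivity, fun φ hφ hn p => ?_⟩
  have hp : (0 : ℝ) < (p : ℝ) + 1 := by positivity
  rw [zpow_neg, zpow_natCast, ← div_eq_mul_inv]
  rcases le_or_gt k (p + 1) with h | h
  · obtain ⟨P, hP, hPf⟩ := hJ _ d hd hφ.1 hφ.2 (p + 1) h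
    refine ⟨P, ?_, fun x => ?_⟩
    · rw [mem_degreeLT, degree_lt_iff_coeff_zero] at hP
      rw [mem_degreeLE, degree_le_iff_coeff_zero]
      exact fun i hi => hP i (by exact_mod_cast hi)
    · have := hPf x x.2
      rw [Set.IccExtend_val] at this
      refine this.trans ?_
      push_cast
      gcongr
      linarith [pow_nonneg (Nat.cast_nonneg (α := ℝ) k) k]
  · refine ⟨0, Submodule.zero_mem _, fun x => ?_⟩
    have h1 : |φ x| ≤ 1 := hn ▸ φ.norm_coe_le_norm x
    have h2 : ((p : ℝ) + 1) ^ k ≤ (k : ℝ) ^ k := by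
      gcongr
      exact_mod_cast h.le
    rw [eval_zero, sub_zero, le_div_iff₀ (by positivity)]
    nlinarith [mul_nonneg hC hd, pow_pos hp k]

theorem interpOp_toContinuousMapOn {p : ℕ} {z : Fin (p + 1) → unitSeg}
    (hz : Function.Injective z) {Q : ℝ[X]} (hQ : Q ∈ degreeLE ℝ p) :
    interpOp z (Q.toContinuousMapOn unitSeg) = Q.toContinuousMapOn unitSeg := by
  rw [interpOp_apply]
  congr 1
  refine (Lagrange.eq_interpolate (s := Finset.univ) (v := fun i => (z i : ℝ)) (f := Q)
    (fun i _ j _ hij => hz (Subtype.ext hij)) ?_).symm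
  rw [mem_degreeLE] at hQ
  refine hQ.trans_lt ?_
  rw [Finset.card_univ, Fintype.card_fin]
  exact_mod_cast Nat.lt_succ_self p

/-- Interpolation is controlled by the values at the nodes alone. -/
theorem norm_interpOp_le_of_forall_node {p : ℕ} (z : Fin (p + 1) → unitSeg) (ψ : C(unitSeg, ℝ))
    {M : ℝ} (hM : 0 ≤ M) (h : ∀ j, |ψ (z j)| ≤ M) : ‖interpOp z ψ‖ ≤ ‖interpOp z‖ * M := by
  -- Truncating `ψ` to `[-M, M]` keeps its nodal values and bounds its uniform norm.
  let χ : C(unitSeg, ℝ) := ⟨fun x => max (-M) (min M (ψ x)), by fun_prop⟩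
  have hχ : ‖χ‖ ≤ M := by
    refine (ContinuousMap.norm_le χ hM).mpr fun x => ?_
    rw [Real.norm_eq_abs, abs_le]
    exact ⟨le_max_left _ _, max_le (by linarith) (min_le_left _ _)⟩
  have heq : interpOp z ψ = interpOp z χ := by
    rw [interpOp_apply, interpOp_apply]
    congr 3
    funext j
    obtain ⟨h1, h2⟩ := abs_le.mp (h j)
    simp only [χ, ContinuousMap.coe_mk]
    rw [min_eq_right h2, max_eq_right h1]
  rw [heq]
  exact ((interpOp z).le_opNorm χ).trans (mul_le_mul_of_nonneg_left hχ (norm_nonneg _))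

theorem nodalWeight_pos {X' : Finset unitSeg} {x : unitSeg} (hx : x ∉ X') :
    0 < nodalWeight X' x := by
  refine sq_pos_of_ne_zero (Finset.prod_ne_zero_iff.mpr fun y hy => sub_ne_zero.mpr fun h => ?_)
  exact hx (Subtype.ext h ▸ hy)

theorem abs_sub_lsqPoly_le {X' X'' : Finset unitSeg} {p : ℕ} {φ : C(unitSeg, ℝ)} {P : ℝ[X]}
    (hP : P ∈ degreeLE ℝ p) {ε : ℝ} (hε : 0 ≤ ε) (hφ : ∀ x : unitSeg, |φ x - P.eval (x : ℝ)| ≤ ε)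
    {y : unitSeg} (hy : y ∈ X'') :
    √(nodalWeight X' y) * |φ y - (lsqPoly X' X'' p φ).eval (y : ℝ)| ≤
      √(∑ x ∈ X'', nodalWeight X' x) * ε := by
  have hw : ∀ x, 0 ≤ nodalWeight X' x := fun x => sq_nonneg _
  have h1 : nodalWeight X' y * (φ y - (lsqPoly X' X'' p φ).eval (y : ℝ)) ^ 2 ≤
      (∑ x ∈ X'', nodalWeight X' x) * ε ^ 2 :=
    calc _ ≤ lsqError X'' (nodalWeight X') φ (lsqPoly X' X'' p φ) :=
          Finset.single_le_sum (f := fun x : unitSeg =>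
            nodalWeight X' x * (φ x - (lsqPoly X' X'' p φ).eval (x : ℝ)) ^ 2)
            (fun x _ => mul_nonneg (hw x) (sq_nonneg _)) hy
      _ ≤ lsqError X'' (nodalWeight X') φ P := (lsqPoly_spec X' X'' p φ).2 P hP
      _ ≤ _ := by
          rw [lsqError, Finset.sum_mul]
          refine Finset.sum_le_sum fun x _ => mul_le_mul_of_nonneg_left ?_ (hw x)
          exact sq_le_sq' (abs_le.mp (hφ x)).1 (abs_le.mp (hφ x)).2
  have h2 := Real.sqrt_le_sqrt h1
  rwa [Real.sqrt_mul (hw y), Real.sqrt_sq_eq_abs,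
    Real.sqrt_mul (Finset.sum_nonneg fun x _ => hw x), Real.sqrt_sq hε] at h2

theorem norm_lsqOp_le {X' X'' : Finset unitSeg} {p : ℕ} {z : Fin (p + 1) → unitSeg}
    (hz : Function.Injective z) (hzX : ∀ j, z j ∈ X'') (hw : ∀ j, 0 < nodalWeight X' (z j))
    {φ : C(unitSeg, ℝ)} (hφ1 : ‖φ‖ = 1) {P : ℝ[X]} (hP : P ∈ degreeLE ℝ p) {ε : ℝ} (hε : 0 ≤ ε)
    (hφ : ∀ x : unitSeg, |φ x - P.eval (x : ℝ)| ≤ ε) :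
    ‖lsqOp X' X'' p φ‖ ≤ ‖interpOp z‖ *
      (1 + √(∑ x ∈ X'', nodalWeight X' x) / (⨅ j, √(nodalWeight X' (z j))) * ε) := by
  set μ : ℝ := ⨅ j, √(nodalWeight X' (z j)) with hμ
  have hμ0 : 0 < μ := by
    obtain ⟨j, hj⟩ := exists_eq_ciInf_of_finite (f := fun j => √(nodalWeight X' (z j)))
    rw [hμ, ← hj]
    exact Real.sqrt_pos.mpr (hw j)
  have hμj : ∀ j, μ ≤ √(nodalWeight X' (z j)) := fun j => ciInf_le (Set.finite_range _).bddBelow j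
  have hsplit : lsqOp X' X'' p φ = interpOp z φ + interpOp z (lsqOp X' X'' p φ - φ) := by
    rw [← map_add, add_sub_cancel]
    exact (interpOp_toContinuousMapOn hz (lsqPoly_spec X' X'' p φ).1).symm
  rw [hsplit, mul_add, mul_one]
  refine (norm_add_le _ _).trans (add_le_add ?_ ?_)
  · simpa [hφ1] using (interpOp z).le_opNorm φ
  · refine norm_interpOp_le_of_forall_node z _ (by positivity) fun j => ?_
    have h1 := abs_sub_lsqPoly_le (X' := X') hP hε hφ (hzX j)
    rw [div_mul_eq_mul_div, le_div_iff₀ hμ0, mul_comm]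
    refine le_trans ?_ h1
    rw [abs_sub_comm]
    exact mul_le_mul_of_nonneg_right (hμj j) (abs_nonneg _)

end LeastSquares

theorem mainTheorem4 (d : ℝ) (hd : 0 < d) (k : ℕ) :
    ∃ D : ℝ, ∀ (n m p : ℕ) (X' X'' : Finset unitSeg) (z : Fin (p + 1) → unitSeg),
      X' ⊆ equiGrid n → X'.card = m + 1 → X'' = equiGrid n \ X' →
      Function.Injective z → (∀ j, z j ∈ X'') →
        BddAbove (unitValues (smoothClass d k) (lsqOp X' X'' p)) ∧
        normOn (smoothClass d k) (lsqOp X' X'' p) ≤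
          ‖interpOp z‖ * (1 + D * (√(∑ x ∈ X'', nodalWeight X' x) /
            ⨅ j, √(nodalWeight X' (z j))) * ((p : ℝ) + 1) ^ (-(k : ℤ))) := by
  obtain ⟨D, hD, hJ⟩ := exists_jackson_constant_smoothClass hd.le k
  refine ⟨D, fun n m p X' X'' z _ _ hX hz hzX => ?_⟩
  have hw : ∀ j, 0 < nodalWeight X' (z j) := fun j =>
    nodalWeight_pos (Finset.mem_sdiff.mp (hX ▸ hzX j)).2
  have hbound : ∀ y ∈ unitValues (smoothClass d k) (lsqOp X' X'' p), y ≤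
      ‖interpOp z‖ * (1 + D * (√(∑ x ∈ X'', nodalWeight X' x) /
        ⨅ j, √(nodalWeight X' (z j))) * ((p : ℝ) + 1) ^ (-(k : ℤ))) := by
    rintro _ ⟨φ, hφ, hφ1, rfl⟩
    obtain ⟨P, hP, hPφ⟩ := hJ φ hφ hφ1 p
    refine (norm_lsqOp_le hz hzX hw hφ1 hP (by positivity) hPφ).trans (le_of_eq ?_)
    ring
  refine ⟨⟨_, hbound⟩, Real.sSup_le hbound ?_⟩
  -- The bound must also be nonnegative, because the supremum of an empty set of values is `0`.
  have : 0 ≤ ⨅ j, √(nodalWeight X' (z j)) := Real.iInf_nonneg fun j => Real.sqrt_nonneg _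
  positivity
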